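/- Let $K$ be a field. For distinct points $p_1,\dots,p_r\in\mathbb{P}^3_K$, $d\ge 0$ and $m=(m_1,\dots,m_r)\in\mathbb{Z}_{\ge0}^r$ let $\mathbb{L}_3(d,m)$ be the linear system of surfaces of degree $d$ with multiplicity at least $m_i$ at $p_i$. Its virtual dimension is $$v(d,m)=\binom{d+3}{3}-\sum_i\binom{m_i+2}{3}-1,$$ its expected dimension is $\max(v(d,m),-1)$, and it is called special if its dimension (which is $-1$ if it is empty) is larger than the expected dimension. Let $X$ be the blow-up of $\mathbb{P}^3$ at the $p_i$, with $H$ the pull-back of a plane and $E_i$ the exceptional divisors, so that $H^3=E_i^3=1$, all mixed products of $H,E_1,\dots,E_r$ vanish, and $K_X=-4H+2\sum_iE_i$. To degree $d$ and multiplicities $m$ corresponds the class $dH-\sum_i m_iE_i$ on $X$, and $v(dH-\sum_i m_iE_i)$ stands for $v(d,m)$. (1) Let $\tilde F=eH-\sum n_iE_i$ and $\tilde M=dH-\sum m_iE_i$ with $e,d,n_i,m_i\ge0$, and let $\tilde L=\tilde F+\tilde M$ (the class of degree $e+d$ and multiplicities $n+m$). Then $$v(\tilde L)=v(\tilde F)+v(\tilde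 M)+\tfrac12\,\tilde F\tilde M(\tilde L-K_X).$$ (2) Let $F$ be a surface of degree $e$ with multiplicity at least $n_i$ at $p_i$, put $\mathbb{M}=\mathbb{L}_3(d,m)$ and $\mathbb{L}=\mathbb{L}_3(e+d,n+m)$, and suppose that $\mathbb{L}=F+\mathbb{M}$, that is, the members of $\mathbb{L}$ are exactly the surfaces $F+D$ with $D\in\mathbb{M}$. If $\mathbb{L}$ is non-empty and $\mathbb{M}$ is non-special, then $\dim\mathbb{L}=\dim\mathbb{M}$, and $\mathbb{L}$ is special whenever $$v(\tilde F)+\tfrac12\,\tilde F\tilde M(\tilde L-K_X)<0.$$ (3) For $r=9$, write $\mathbb{L}_3(d,a,b^8)$ for the system with multiplicities $(a,b,\dots,b)$. For the classes $\tilde F=\tilde Q=2H-\sum_{i=0}^8E_i$ and $\tilde M=7H-5E_0-3\sum_{i=1}^8E_i$, with sum $\tilde L=9H-6E_0-4\sum_{i=1}^8E_i$, one has $v(\tilde Q)=0$ and $\tfrac12\tilde Q\tilde M(\tilde L-K_X)=-1$, so that the quantity in (2) is $0+(-1)=-1$. The system $\mathbb{L}_3(9,6,4^8)$ is special for any nine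 distinct points. If $K$ has characteristic $0$ and the nine points are general, the criterion (2) accounts for this: there is exactly one quadric $Q$ through the nine points, $\mathbb{L}_3(9,6,4^8)=Q+\mathbb{L}_3(7,5,3^8)$, the system $\mathbb{L}_3(9,6,4^8)$ is non-empty, and $\mathbb{L}_3(7,5,3^8)$ is non-special. -/

import Mathlib

open scoped LinearAlgebra.Projectivization

namespace FatPoints

noncomputable section

/-- Projective 3-space over `K`. -/
abbrev P3 (K : Type*) [Field K] := ℙ K (Fin 4 → K)

/-- The forms of degree `d` in four variables whose zero surface has multiplicity at least `m i`
at the point `p i`, for every `i`. The multiplicity of `f = 0` at a point with homogeneous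
coordinates `v` is at least `k` when `f` lies in the `k`-th power of the ideal of polynomials
vanishing at `v`; for a form `f` this does not depend on the choice of `v`. The linear system
`L₃(d, m)` at the points `p` is the projectivization of this space. -/
def linearSystem {K : Type*} [Field K] {r : ℕ} (p : Fin r → P3 K) (d : ℕ) (m : Fin r → ℕ) :
    Submodule K (MvPolynomial (Fin 4) K) :=
  MvPolynomial.homogeneousSubmodule (Fin 4) K d ⊓
    ⨅ i, ((RingHom.ker (MvPolynomial.eval (p i).rep)) ^ (m i)).restrictScalars K

/-- The (projective) dimension of the linear system `L₃(d, m)`; it is `-1` for an empty system. -/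
def effectiveDim {K : Type*} [Field K] {r : ℕ} (p : Fin r → P3 K) (d : ℕ) (m : Fin r → ℕ) : ℤ :=
  (Module.finrank K (linearSystem p d m) : ℤ) - 1

/-- The virtual dimension of `L₃(d, m)`. -/
def virtualDim {r : ℕ} (d : ℕ) (m : Fin r → ℕ) : ℤ :=
  ((d + 3).choose 3 : ℤ) - ∑ i, ((m i + 2).choose 3 : ℤ) - 1

/-- The expected dimension of `L₃(d, m)`. -/
def expectedDim {r : ℕ} (d : ℕ) (m : Fin r → ℕ) : ℤ := max (virtualDim d m) (-1)

/-- A linear system is special if its expected dimension is smaller than its dimension. -/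
def IsSpecial {K : Type*} [Field K] {r : ℕ} (p : Fin r → P3 K) (d : ℕ) (m : Fin r → ℕ) : Prop :=
  expectedDim d m < effectiveDim p d m

/-- `L₃(e + d, n + m) = F + L₃(d, m)`, where `F` is the surface `f = 0` of degree `e` with
multiplicity at least `n i` at `p i`: the members of the system on the left are exactly the
surfaces `F + D` with `D` in the system on the right. -/
def HasFixedPart {K : Type*} [Field K] {r : ℕ} (p : Fin r → P3 K)
    (f : MvPolynomial (Fin 4) K) (e : ℕ) (n : Fin r → ℕ) (d : ℕ) (m : Fin r → ℕ) : Prop :=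
  f ≠ 0 ∧ f ∈ linearSystem p e n ∧
    linearSystem p (e + d) (n + m) = (linearSystem p d m).map (LinearMap.mulLeft K f)

/-! The Chow groups of the blow-up `X` of projective 3-space at `r` distinct points, with their
intersection products. -/

/-- `A¹(X) = Pic X`: the pair `(a, b)` is the class `a H + ∑ b i E_i`, with `H` the pull-back of
a plane and `E_i` the exceptional divisors. -/
abbrev DivisorClass (r : ℕ) := ℤ × (Fin r → ℤ)

/-- `A²(X)`: the pair `(a, b)` is the class `a h + ∑ b i e_i`, with `h` the pull-back of a line
and `e_i` a line in `E_i`. -/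
abbrev CurveClass (r : ℕ) := ℤ × (Fin r → ℤ)

/-- The product `A¹(X) × A¹(X) → A²(X)`, determined by `H² = h`, `E_i² = -e_i` and
`H E_i = E_i E_j = 0` for `i ≠ j`. -/
def interDiv {r : ℕ} (A B : DivisorClass r) : CurveClass r :=
  (A.1 * B.1, fun i => -(A.2 i * B.2 i))

/-- The product `A²(X) × A¹(X) → A³(X)`, followed by the degree: `h H = 1`, `e_i E_i = -1`,
and `h E_i = e_i H = e_i E_j = 0` for `i ≠ j`. -/
def interDeg {r : ℕ} (C : CurveClass r) (A : DivisorClass r) : ℤ :=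
  C.1 * A.1 - ∑ i, C.2 i * A.2 i

/-- The intersection number `A · B · C` of three divisor classes on `X`. -/
def tripleInter {r : ℕ} (A B C : DivisorClass r) : ℤ := interDeg (interDiv A B) C

/-- The class `d H - ∑ m i E_i` on `X`. -/
def tildeClass {r : ℕ} (d : ℕ) (m : Fin r → ℕ) : DivisorClass r := (d, fun i => -(m i : ℤ))

/-- The canonical class `K_X = -4 H + 2 ∑ E_i`. -/
def canonicalClass (r : ℕ) : DivisorClass r := (-4, fun _ => 2)

/-- The number `F̃ · M̃ · (L̃ - K_X) / 2`, with `F̃ = e H - ∑ n i E_i`, `M̃ = d H - ∑ m i E_i` and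
`L̃ = F̃ + M̃`. -/
def correction {r : ℕ} (e : ℕ) (n : Fin r → ℕ) (d : ℕ) (m : Fin r → ℕ) : ℚ :=
  (tripleInter (tildeClass e n) (tildeClass d m)
    (tildeClass e n + tildeClass d m - canonicalClass r) : ℚ) / 2

/-- The multiplicities `(a, b, …, b)` at nine points: `a` at the first one, `b` at the others. -/
def nineMult (a b : ℕ) : Fin 9 → ℕ := fun i => if i = 0 then a else b

/-- `S` holds for `r` general points of projective 3-space over `K`: it holds off the zero locus
of some nonzero polynomial in the homogeneous coordinates of the `r` points. -/
def ForGeneralPoints (K : Type*) [Field K] (r : ℕ) (S : (Fin r → P3 K) → Prop) : Prop :=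
  ∃ P : MvPolynomial (Fin r × Fin 4) K, P ≠ 0 ∧
    ∀ (w : Fin r → Fin 4 → K) (hw : ∀ i, w i ≠ 0),
      MvPolynomial.eval (fun ij => w ij.1 ij.2) P ≠ 0 →
        S (fun i => Projectivization.mk K (w i) (hw i))

end

end FatPoints

/-! The formula for the virtual dimension is a polynomial identity, degree by degree and point by
point.

The criterion rests on the bound dim ≥ v, valid in every characteristic because multiplicity k at a
point costs at most binom(k+2, 3) linear conditions (`choose_le_finrank_linearSystem`).
Multiplication by the equation of F is injective, so dim L = dim M ≥ v(M). If v(F) plus the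
correction is negative, then v(M) > v(L), while dim L ≥ 0 because L is non-empty; so L is special.

For nine points the same bound gives a quadric and a 5-dimensional space of septics. Their products
lie in L₃(9, 6, 4⁸), whose dimension is therefore at least 4, whereas its virtual dimension is 3. At
general points it remains to bound the vector spaces of quadrics and nonics above by 1 and 5; a
squeeze then gives the rest (`fixedPart_nonics`).

These upper bounds come from semicontinuity. The conditions form a matrix of integer polynomials in
the coordinates of the points (`conditionMatrix`). If its columns outside a set of B monomials are
independent at one choice of points modulo 11, they are independent at general points in
characteristic 0, and the system has at most B independent members (`forGeneralPoints_finrank_le`).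
With four points at the coordinate points, most conditions just delete monomials, and the rest is a
small Gaussian elimination run by the kernel. -/

namespace FatPoints

open MvPolynomial

universe u

/-! ### Virtual dimensions -/

theorem cast_choose_three (n : ℕ) :
    ((n + 2).choose 3 : ℚ) = (n + 2) * (n + 1) * n / 6 := by
  have h := Nat.descFactorial_eq_factorial_mul_choose (n + 2) 3
  simp only [Nat.descFactorial, Nat.factorial] at h
  have h' : (n + 2 - 2) * ((n + 2 - 1) * (n + 2)) = 6 * (n + 2).choose 3 := by
    simpa using h
  rw [show n + 2 - 2 = n by omega, show n + 2 - 1 = n + 1 by omega] at h'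
  have h'' : (n : ℚ) * ((n + 1) * (n + 2)) = 6 * ((n + 2).choose 3 : ℚ) := by
    exact_mod_cast h'
  linarith

theorem tildeClass_add {r : ℕ} (e d : ℕ) (n m : Fin r → ℕ) :
    tildeClass (e + d) (n + m) = tildeClass e n + tildeClass d m := by
  ext <;> simp [tildeClass]
  ring

theorem virtualDim_add {r : ℕ} (e d : ℕ) (n m : Fin r → ℕ) :
    (virtualDim (e + d) (n + m) : ℚ) =
      virtualDim e n + virtualDim d m + correction e n d m := by
  have key : ∀ a : ℕ, ((a + 3).choose 3 : ℚ) = (a + 3) * (a + 2) * (a + 1) / 6 := by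
    intro a
    have := cast_choose_three (a + 1)
    push_cast at this
    rw [show a + 3 = a + 1 + 2 by ring, this]
    ring
  simp only [virtualDim, correction, tripleInter, interDeg, interDiv, tildeClass, canonicalClass]
  push_cast
  simp only [key, cast_choose_three, Pi.add_apply, Prod.fst_add, Prod.snd_add, Prod.fst_sub,
    Prod.snd_sub, Pi.sub_apply]
  push_cast
  -- The contribution of a single point: the last term is half the `E_i`-part of the triple product.
  have hs : ∀ i, ((n i + m i : ℚ) + 2) * (n i + m i + 1) * (n i + m i) / 6 =
      (n i + 2) * (n i + 1) * n i / 6 + (m i + 2) * (m i + 1) * m i / 6 +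
      (-(-(n i : ℚ) * -(m i : ℚ))) * (-(n i : ℚ) + -(m i : ℚ) - 2) / 2 := fun i => by ring
  simp only [hs, Finset.sum_add_distrib, ← Finset.sum_div]
  ring

/-! ### The expected dimension is a lower bound -/

instance finite_homogeneousSubmodule (K : Type*) [Field K] (d : ℕ) :
    Module.Finite K (homogeneousSubmodule (Fin 4) K d) :=
  Module.Finite.iff_fg.mpr (homogeneousSubmodule_fg (Fin 4) K d)

instance finite_linearSystem {K : Type*} [Field K] {r : ℕ} (p : Fin r → P3 K) (d : ℕ)
    (m : Fin r → ℕ) : Module.Finite K (linearSystem p d m) :=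
  Module.Finite.of_injective (Submodule.inclusion inf_le_left)
    (Submodule.inclusion_injective (inf_le_left :
      linearSystem p d m ≤ homogeneousSubmodule (Fin 4) K d))

theorem mem_linearSystem {K : Type*} [Field K] {r : ℕ} {p : Fin r → P3 K} {d : ℕ}
    {m : Fin r → ℕ} {f : MvPolynomial (Fin 4) K} :
    f ∈ linearSystem p d m ↔
      f.IsHomogeneous d ∧ ∀ i, f ∈ RingHom.ker (eval (p i).rep) ^ m i := by
  simp [linearSystem]

/-- The exponents of the monomials of degree `d` in four variables. -/
noncomputable def exponents (d : ℕ) : Finset (Fin 4 →₀ ℕ) := Finset.finsuppAntidiag Finset.univ d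

theorem mem_exponents {d : ℕ} {a : Fin 4 →₀ ℕ} : a ∈ exponents d ↔ a.degree = d := by
  simp [exponents, Finsupp.degree_eq_sum]

theorem card_exponents (d : ℕ) : (exponents d).card = (d + 3).choose 3 := by
  rw [exponents, Finset.card_finsuppAntidiag_nat_eq_choose, Finset.card_univ, Fintype.card_fin,
    show 4 + d - 1 = d + 3 by omega, ← Nat.choose_symm_of_eq_add (n := d + 3) (a := d) (b := 3) rfl]

theorem choose_le_finrank_homogeneousSubmodule (K : Type*) [Field K] (d : ℕ) :
    (d + 3).choose 3 ≤ Module.finrank K (homogeneousSubmodule (Fin 4) K d) := by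
  have hli : LinearIndependent K (fun a : exponents d =>
      (⟨monomial a.1 1, isHomogeneous_monomial 1 (mem_exponents.mp a.2)⟩ :
        homogeneousSubmodule (Fin 4) K d)) := by
    apply LinearIndependent.of_comp (homogeneousSubmodule (Fin 4) K d).subtype
    have := (basisMonomials (Fin 4) K).linearIndependent.comp
      (fun a : exponents d => a.1) Subtype.val_injective
    convert this using 1
    ext1 a
    simp
  have := hli.fintype_card_le_finrank
  rwa [Fintype.card_coe, card_exponents] at this

/-- The substitution `x_i ↦ x_i + c_i x_j` for `i ≠ j`. -/
noncomputable def shear {K : Type*} [Field K] (j : Fin 4) (c : Fin 4 → K) :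
    MvPolynomial (Fin 4) K →ₐ[K] MvPolynomial (Fin 4) K :=
  aeval fun i => if i = j then X j else X i + C (c i) * X j

theorem shear_neg_shear {K : Type*} [Field K] (j : Fin 4) (c : Fin 4 → K)
    (f : MvPolynomial (Fin 4) K) : shear j (-c) (shear j c f) = f := by
  have : (shear j (-c)).comp (shear j c) = AlgHom.id K _ := by
    apply algHom_ext
    intro i
    by_cases h : i = j <;> simp [shear, h, algebraMap_eq]
  exact congrArg (fun φ : MvPolynomial (Fin 4) K →ₐ[K] MvPolynomial (Fin 4) K => φ f) this

theorem isHomogeneous_shear {K : Type*} [Field K] (j : Fin 4) (c : Fin 4 → K) {d : ℕ}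
    {f : MvPolynomial (Fin 4) K} (hf : f.IsHomogeneous d) : (shear j c f).IsHomogeneous d := by
  have := hf.aeval (n := 1) (fun i => if i = j then X j else X i + C (c i) * X j :
    Fin 4 → MvPolynomial (Fin 4) K) ?_
  · simpa [shear] using this
  · intro i
    split_ifs
    · exact isHomogeneous_X _ _
    · exact (isHomogeneous_X _ _).add ((isHomogeneous_X _ _).C_mul _)

theorem prod_pow_mem_pow {R ι : Type*} [CommRing R] (I : Ideal R) (s : Finset ι) (y : ι → R)
    (hy : ∀ i ∈ s, y i ∈ I) (a : ι → ℕ) : ∏ i ∈ s, y i ^ a i ∈ I ^ ∑ i ∈ s, a i := by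
  rw [← Finset.prod_pow_eq_pow_sum]
  exact Ideal.prod_mem_prod fun i hi => Ideal.pow_mem_pow (hy i hi) _

/-- The exponents of degree `d` whose part off the `j`-th coordinate has degree less than `k`. -/
noncomputable def lowExponents (d k : ℕ) (j : Fin 4) : Finset (Fin 4 →₀ ℕ) :=
  (exponents d).filter fun a => d < k + a j

theorem card_lowExponents_le (d k : ℕ) (j : Fin 4) :
    (lowExponents d k j).card ≤ (k + 2).choose 3 := by
  rcases k with _ | k
  · rw [lowExponents, Finset.filter_false_of_mem]
    · simp
    · intro a ha
      have := Finsupp.le_degree j a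
      rw [mem_exponents.mp ha] at this
      omega
  · rw [show k + 1 + 2 = k + 3 by ring, ← card_exponents]
    -- The `j`-th entry is determined by the others, so it may be replaced by the one that brings
    -- the total degree down to `k`; the condition `d < k + 1 + a j` makes the subtraction exact.
    apply Finset.card_le_card_of_injOn (fun a => a.erase j + Finsupp.single j (k + a j - d))
    · intro a ha
      simp only [lowExponents, Finset.coe_filter, Set.mem_ofPred_eq, mem_exponents] at ha
      have h1 : (a.erase j).degree + a j = d := by
        rw [← ha.1]
        conv_rhs => rw [← Finsupp.erase_add_single j a]
        simp
      simp only [Finset.mem_coe, mem_exponents, map_add, Finsupp.degree_single]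
      omega
    · intro a ha b hb hab
      simp only [lowExponents, Finset.coe_filter, Set.mem_ofPred_eq, mem_exponents] at ha hb
      have h2 := DFunLike.congr_fun hab j
      simp only [Finsupp.coe_add, Pi.add_apply, Finsupp.erase_same, Finsupp.single_eq_same] at h2
      ext i
      by_cases hi : i = j
      · subst hi; omega
      · have := DFunLike.congr_fun hab i
        simpa [Finsupp.erase_ne hi, Finsupp.single_eq_of_ne hi] using this

/-- The shear moves the point `v` to the `j`-th coordinate point, where multiplicity can be read off
the monomials. Shearing back turns each `x_i` with `i ≠ j` into `x_i - (v i / v j) x_j`, which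
vanishes at `v`. -/
theorem mem_ker_eval_pow_of_coeff_shear {K : Type*} [Field K] {v : Fin 4 → K} {j : Fin 4}
    (hv : v j ≠ 0) {d k : ℕ} {f : MvPolynomial (Fin 4) K} (hf : f.IsHomogeneous d)
    (h : ∀ a ∈ lowExponents d k j, coeff a (shear j (fun i => v i / v j) f) = 0) :
    f ∈ RingHom.ker (eval v) ^ k := by
  rw [← shear_neg_shear j (fun i => v i / v j) f]
  set g := shear j (fun i => v i / v j) f with hg
  have hgh : g.IsHomogeneous d := isHomogeneous_shear j _ hf
  rw [shear, aeval_def, eval₂_eq']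
  refine Ideal.sum_mem _ fun a ha => Ideal.mul_mem_left _ _ ?_
  -- The power of `x_j` is split off; the other factors lie in the ideal and their exponents add up
  -- to at least `k`.
  rw [← Finset.mul_prod_erase _ _ (Finset.mem_univ j)]
  apply Ideal.mul_mem_left
  have hmem := prod_pow_mem_pow (RingHom.ker (eval v)) (Finset.univ.erase j)
    (fun i => if i = j then X j else X i + C ((-fun i => v i / v j) i) * X j) ?_ a
  · refine Ideal.pow_le_pow_right ?_ hmem
    have hd : a.degree = d := by
      rw [Finsupp.degree_eq_weight_one]
      exact hgh (mem_support_iff.mp ha)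
    have h1 : a ∉ lowExponents d k j := fun h1 => mem_support_iff.mp ha (h a h1)
    simp only [lowExponents, Finset.mem_filter, mem_exponents, not_and, not_lt] at h1
    have h2 := h1 hd
    rw [Finsupp.degree_eq_sum, ← Finset.add_sum_erase _ _ (Finset.mem_univ j)] at hd
    omega
  · intro i hi
    simp [Finset.ne_of_mem_erase hi, RingHom.mem_ker, hv]

theorem choose_le_finrank_linearSystem {K : Type*} [Field K] {r : ℕ} (p : Fin r → P3 K) (d : ℕ)
    (m : Fin r → ℕ) : (d + 3).choose 3 ≤
      Module.finrank K (linearSystem p d m) + ∑ i, (m i + 2).choose 3 := by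
  have hj : ∀ i, ∃ j, (p i).rep j ≠ 0 := fun i => Function.ne_iff.mp (p i).rep_nonzero
  choose j hj using hj
  -- The conditions at all points together: the low coefficients of the form after each point is
  -- sheared to a coordinate point.
  let Φ : homogeneousSubmodule (Fin 4) K d →ₗ[K] ((i : Fin r) → lowExponents d (m i) (j i) → K) :=
    LinearMap.pi fun i => LinearMap.pi fun a => (lcoeff K a.1) ∘ₗ
      (shear (j i) fun l => (p i).rep l / (p i).rep (j i)).toLinearMap ∘ₗ
        (homogeneousSubmodule (Fin 4) K d).subtype
  have hker : (LinearMap.ker Φ).map (homogeneousSubmodule (Fin 4) K d).subtype ≤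
      linearSystem p d m := by
    rintro _ ⟨f, hf, rfl⟩
    refine mem_linearSystem.mpr ⟨f.2, fun i => ?_⟩
    refine mem_ker_eval_pow_of_coeff_shear (hj i) f.2 fun a ha => ?_
    exact congrFun (congrFun (LinearMap.mem_ker.mp hf) i) ⟨a, ha⟩
  have h1 := Submodule.finrank_mono hker
  rw [(Submodule.equivMapOfInjective _ (Submodule.injective_subtype _) _).symm.finrank_eq] at h1
  have h2 := Φ.finrank_range_add_finrank_ker
  have h3 := Submodule.finrank_le (LinearMap.range Φ)
  rw [Module.finrank_pi_fintype] at h3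
  simp only [Module.finrank_fintype_fun_eq_card, Fintype.card_coe] at h3
  have h4 := choose_le_finrank_homogeneousSubmodule K d
  have h5 : ∑ i, (lowExponents d (m i) (j i)).card ≤ ∑ i, (m i + 2).choose 3 :=
    Finset.sum_le_sum fun i _ => card_lowExponents_le d (m i) (j i)
  omega

theorem expectedDim_le_effectiveDim {K : Type*} [Field K] {r : ℕ} (p : Fin r → P3 K) (d : ℕ)
    (m : Fin r → ℕ) : expectedDim d m ≤ effectiveDim p d m := by
  have h : (((d + 3).choose 3 : ℕ) : ℤ) ≤
      ((Module.finrank K (linearSystem p d m) + ∑ i, (m i + 2).choose 3 : ℕ) : ℤ) := by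
    exact_mod_cast choose_le_finrank_linearSystem p d m
  push_cast at h
  simp only [expectedDim, effectiveDim, virtualDim]
  apply max_le <;> omega

/-! ### Fixed parts -/

theorem effectiveDim_eq_of_hasFixedPart {K : Type*} [Field K] {r : ℕ} {p : Fin r → P3 K}
    {f : MvPolynomial (Fin 4) K} {e d : ℕ} {n m : Fin r → ℕ} (h : HasFixedPart p f e n d m) :
    effectiveDim p (e + d) (n + m) = effectiveDim p d m := by
  have hinj : Function.Injective (LinearMap.mulLeft K f) := mul_right_injective₀ h.1
  rw [effectiveDim, effectiveDim, h.2.2,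
    (Submodule.equivMapOfInjective _ hinj (linearSystem p d m)).finrank_eq]

/-- The chain is v(L) < v(M) ≤ dim M = dim L, together with -1 < dim L since L is non-empty. -/
theorem isSpecial_of_hasFixedPart {K : Type*} [Field K] {r : ℕ} {p : Fin r → P3 K}
    {f : MvPolynomial (Fin 4) K} {e d : ℕ} {n m : Fin r → ℕ} (h : HasFixedPart p f e n d m)
    (hne : linearSystem p (e + d) (n + m) ≠ ⊥)
    (hneg : (virtualDim e n : ℚ) + correction e n d m < 0) :
    IsSpecial p (e + d) (n + m) := by
  have hpos : 0 < Module.finrank K (linearSystem p (e + d) (n + m)) :=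
    Module.finrank_pos_iff.mpr ((Submodule.nontrivial_iff_ne_bot).mpr hne)
  have h1 := effectiveDim_eq_of_hasFixedPart h
  have h2 := expectedDim_le_effectiveDim p d m
  have h3 : virtualDim (e + d) (n + m) < virtualDim d m := by
    have h4 : (virtualDim (e + d) (n + m) : ℚ) < virtualDim d m := by
      rw [virtualDim_add]; linarith
    exact_mod_cast h4
  have h5 : 0 ≤ effectiveDim p (e + d) (n + m) := by
    simp only [effectiveDim]; omega
  have h6 : virtualDim d m ≤ expectedDim d m := le_max_left _ _
  rw [IsSpecial, expectedDim]
  apply max_lt <;> omega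

theorem mul_mem_linearSystem {K : Type*} [Field K] {r : ℕ} {p : Fin r → P3 K}
    {f g : MvPolynomial (Fin 4) K} {e d : ℕ} {n m : Fin r → ℕ} (hf : f ∈ linearSystem p e n)
    (hg : g ∈ linearSystem p d m) : f * g ∈ linearSystem p (e + d) (n + m) := by
  rw [mem_linearSystem] at *
  refine ⟨hf.1.mul hg.1, fun i => ?_⟩
  rw [Pi.add_apply, pow_add]
  exact Ideal.mul_mem_mul (hf.2 i) (hg.2 i)

/-! ### The system `L₃(9, 6, 4⁸)` -/

theorem nineMult_add (a b a' b' : ℕ) :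
    nineMult (a + a') (b + b') = nineMult a b + nineMult a' b' := by
  ext i
  simp only [nineMult, Pi.add_apply]
  split_ifs <;> rfl

theorem virtualDim_nineMult (d a b : ℕ) : virtualDim d (nineMult a b) =
    (d + 3).choose 3 - ((a + 2).choose 3 + 8 * (b + 2).choose 3) - 1 := by
  simp [virtualDim, nineMult, Fin.sum_univ_succ]

/-- By additivity the correction is 3 - 0 - 4, the difference of the virtual dimensions. -/
theorem correction_nineMult :
    correction 2 (nineMult 1 1) 7 (nineMult 5 3) = -1 := by
  have h := virtualDim_add 2 7 (nineMult 1 1) (nineMult 5 3)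
  rw [← nineMult_add, virtualDim_nineMult, virtualDim_nineMult, virtualDim_nineMult] at h
  norm_num [Nat.choose] at h
  linarith

theorem one_le_finrank_quadrics {K : Type*} [Field K] (p : Fin 9 → P3 K) :
    1 ≤ Module.finrank K (linearSystem p 2 (nineMult 1 1)) := by
  have h := (le_max_left _ _).trans (expectedDim_le_effectiveDim p 2 (nineMult 1 1))
  rw [virtualDim_nineMult, effectiveDim] at h
  norm_num [Nat.choose] at h
  exact Submodule.one_le_finrank_iff.mpr h

theorem five_le_finrank_septics {K : Type*} [Field K] (p : Fin 9 → P3 K) :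
    5 ≤ Module.finrank K (linearSystem p 7 (nineMult 5 3)) := by
  have h := (le_max_left _ _).trans (expectedDim_le_effectiveDim p 7 (nineMult 5 3))
  rw [virtualDim_nineMult, effectiveDim] at h
  norm_num [Nat.choose] at h
  omega

theorem map_mulLeft_le_nonics {K : Type*} [Field K] {p : Fin 9 → P3 K}
    {q : MvPolynomial (Fin 4) K} (hq : q ∈ linearSystem p 2 (nineMult 1 1)) :
    (linearSystem p 7 (nineMult 5 3)).map (LinearMap.mulLeft K q) ≤
      linearSystem p 9 (nineMult 6 4) := by
  rintro _ ⟨g, hg, rfl⟩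
  exact nineMult_add 1 1 5 3 ▸ mul_mem_linearSystem hq hg

theorem finrank_map_mulLeft {K : Type*} [Field K] {q : MvPolynomial (Fin 4) K} (hq : q ≠ 0)
    (V : Submodule K (MvPolynomial (Fin 4) K)) :
    Module.finrank K (V.map (LinearMap.mulLeft K q)) = Module.finrank K V :=
  (Submodule.equivMapOfInjective _ (mul_right_injective₀ hq) V).finrank_eq.symm

theorem isSpecial_nonics {K : Type*} [Field K] (p : Fin 9 → P3 K) :
    IsSpecial p 9 (nineMult 6 4) := by
  obtain ⟨q, hq, hq0⟩ := Submodule.exists_mem_ne_zero_of_ne_bot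
    ((Submodule.nontrivial_iff_ne_bot).mp (Module.finrank_pos_iff.mp (one_le_finrank_quadrics p)))
  have h1 := Submodule.finrank_mono (map_mulLeft_le_nonics hq)
  rw [finrank_map_mulLeft hq0] at h1
  have h2 := five_le_finrank_septics p
  rw [IsSpecial, expectedDim, effectiveDim, virtualDim_nineMult]
  norm_num [Nat.choose]
  omega

/-- Multiplying septics by the quadric gives 5 ≤ dim(septics) ≤ dim(nonics) ≤ 5 for the vector
spaces. Equality throughout makes the quadric a fixed part and gives the septics their virtual
dimension 4. -/
theorem fixedPart_nonics {K : Type*} [Field K] {p : Fin 9 → P3 K}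
    (h2 : Module.finrank K (linearSystem p 2 (nineMult 1 1)) ≤ 1)
    (h9 : Module.finrank K (linearSystem p 9 (nineMult 6 4)) ≤ 5) :
    ∃ q : MvPolynomial (Fin 4) K,
      linearSystem p 2 (nineMult 1 1) = Submodule.span K {q} ∧
      HasFixedPart p q 2 (nineMult 1 1) 7 (nineMult 5 3) ∧
      linearSystem p 9 (nineMult 6 4) ≠ ⊥ ∧ ¬ IsSpecial p 7 (nineMult 5 3) := by
  obtain ⟨q, hq, hq0⟩ := Submodule.exists_mem_ne_zero_of_ne_bot
    ((Submodule.nontrivial_iff_ne_bot).mp (Module.finrank_pos_iff.mp (one_le_finrank_quadrics p)))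
  have hle := map_mulLeft_le_nonics hq
  have h7 := five_le_finrank_septics p
  have h97 := Submodule.finrank_mono hle
  rw [finrank_map_mulLeft hq0] at h97
  refine ⟨q, ?_, ⟨hq0, hq, ?_⟩, ?_, ?_⟩
  · symm
    apply Submodule.eq_of_le_of_finrank_le
    · simpa using hq
    · rwa [finrank_span_singleton hq0]
  · rw [← nineMult_add]
    symm
    apply Submodule.eq_of_le_of_finrank_le hle
    rw [finrank_map_mulLeft hq0]
    omega
  · intro h
    rw [h, finrank_bot] at h97
    omega
  · rw [IsSpecial, expectedDim, effectiveDim, virtualDim_nineMult]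
    norm_num [Nat.choose]
    omega

/-! ### Taylor coefficients -/

/-- The coefficient of `t ^ α` in the expansion of the monomial `(w + t) ^ a`. -/
def taylorCoeff {R : Type*} [CommSemiring R] (w : Fin 4 → R) (α a : Fin 4 →₀ ℕ) : R :=
  ∏ j, ((a j).choose (α j) : R) * w j ^ (a j - α j)

theorem map_taylorCoeff {R S : Type*} [CommSemiring R] [CommSemiring S] (φ : R →+* S)
    (w : Fin 4 → R) (α a : Fin 4 →₀ ℕ) :
    φ (taylorCoeff w α a) = taylorCoeff (fun j => φ (w j)) α a := by
  simp [taylorCoeff, map_prod]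

theorem coeff_prod_X_add_C_pow {R : Type*} [CommRing R] (w : Fin 4 → R) (α a : Fin 4 →₀ ℕ) :
    coeff α (∏ j, (X j + C (w j)) ^ a j : MvPolynomial (Fin 4) R) = taylorCoeff w α a := by
  have hpow : ∀ j, (X j + C (w j) : MvPolynomial (Fin 4) R) ^ a j =
      ∑ k ∈ Finset.range (a j + 1),
        monomial (Finsupp.single j k) (((a j).choose k : R) * w j ^ (a j - k)) := by
    intro j
    rw [add_pow]
    refine Finset.sum_congr rfl fun k _ => ?_
    rw [← C_mul_X_pow_eq_monomial, C_mul, C_pow, ← map_natCast (C : R →+* MvPolynomial (Fin 4) R)]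
    ring
  have hmono : ∀ k : Fin 4 → ℕ, (∏ j, monomial (Finsupp.single j (k j))
      (((a j).choose (k j) : R) * w j ^ (a j - k j)) : MvPolynomial (Fin 4) R) =
      monomial (Finsupp.equivFunOnFinite.symm k)
        (∏ j, ((a j).choose (k j) : R) * w j ^ (a j - k j)) := by
    intro k
    rw [← Finsupp.univ_sum_single (Finsupp.equivFunOnFinite.symm k), monomial_sum_index, map_prod]
    simp only [← Finset.prod_mul_distrib, Finsupp.coe_equivFunOnFinite_symm, C_mul_monomial, mul_one]
  simp_rw [hpow]
  rw [Finset.prod_univ_sum, coeff_sum]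
  simp_rw [hmono, coeff_monomial]
  have : ∀ k : Fin 4 → ℕ, (Finsupp.equivFunOnFinite.symm k = α) ↔ k = α := fun k =>
    ⟨fun h => by rw [← h]; rfl, fun h => by ext j; exact congrFun h j⟩
  simp_rw [this]
  rw [Finset.sum_ite_eq']
  split_ifs with h
  · rfl
  · simp only [Fintype.mem_piFinset, Finset.mem_range, not_forall, not_lt] at h
    obtain ⟨j, hj⟩ := h
    rw [taylorCoeff, Finset.prod_eq_zero (Finset.mem_univ j)]
    rw [Nat.choose_eq_zero_of_lt (by omega), Nat.cast_zero, zero_mul]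

/-- Translation by `w` carries the ideal of `w` into that of the origin, so the coefficients of `f(x
+ w)` in degree less than `m` vanish. Taylor coefficients replace derivatives, so no factorials are
inverted. -/
theorem sum_taylorCoeff_eq_zero {K : Type*} [Field K] {w : Fin 4 → K} {d m : ℕ}
    {f : MvPolynomial (Fin 4) K} (hf : f.IsHomogeneous d) (hm : f ∈ RingHom.ker (eval w) ^ m)
    {α : Fin 4 →₀ ℕ} (hα : α.degree < m) :
    ∑ a ∈ exponents d, coeff a f * taylorCoeff w α a = 0 := by
  let τ : MvPolynomial (Fin 4) K →ₐ[K] MvPolynomial (Fin 4) K := aeval fun j => X j + C (w j)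
  have hτ : τ f ∈ idealOfVars (Fin 4) K ^ m := by
    have h1 : (RingHom.ker (eval w)).map τ ≤ idealOfVars (Fin 4) K := by
      rw [Ideal.map_le_iff_le_comap]
      intro g hg
      have h0 : eval (0 : Fin 4 → K) (τ g) = 0 := by
        have : (eval (0 : Fin 4 → K)).comp (τ : MvPolynomial (Fin 4) K →+* _) = eval w := by
          apply ringHom_ext <;> intro <;> simp [τ]
        exact (congrArg (fun φ : MvPolynomial (Fin 4) K →+* K => φ g) this).trans hg
      rw [Ideal.mem_comap, ← pow_one (idealOfVars (Fin 4) K), mem_pow_idealOfVars_iff']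
      intro x hx
      have : x = 0 := (Finsupp.degree_eq_zero_iff x).mp (by omega)
      rw [this]
      simpa [constantCoeff_eq] using h0
    exact Ideal.pow_right_mono h1 m (Ideal.map_pow τ _ m ▸ Ideal.mem_map_of_mem τ hm)
  have h := (mem_pow_idealOfVars_iff' m _).mp hτ α hα
  rw [show τ f = ∑ a ∈ f.support, C (coeff a f) * ∏ j, (X j + C (w j)) ^ a j from by
    simp only [τ]; rw [aeval_def, eval₂_eq']; rfl, coeff_sum] at h
  simp_rw [coeff_C_mul, coeff_prod_X_add_C_pow] at h
  rw [← h]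
  symm
  apply Finset.sum_subset
  · intro a ha
    rw [mem_exponents, Finsupp.degree_eq_weight_one]
    exact hf (mem_support_iff.mp ha)
  · intro a _ ha
    rw [notMem_support_iff.mp ha, zero_mul]

/-- Needed to pass from the chosen representative of a point to given coordinates. The scaling `x ↦
c x` multiplies a form by `c ^ d` and carries the ideal of `c • w` into that of `w`. -/
theorem mem_ker_eval_pow_of_smul {K : Type*} [Field K] {w : Fin 4 → K} {c : K} (hc : c ≠ 0)
    {d m : ℕ} {f : MvPolynomial (Fin 4) K} (hf : f.IsHomogeneous d)
    (hm : f ∈ RingHom.ker (eval (c • w)) ^ m) : f ∈ RingHom.ker (eval w) ^ m := by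
  let σ : MvPolynomial (Fin 4) K →ₐ[K] MvPolynomial (Fin 4) K := aeval fun j => C c * X j
  have hσ : σ f = C (c ^ d) * f := by
    simp only [σ]
    rw [aeval_def, eval₂_eq']
    conv_rhs => rw [f.as_sum, Finset.mul_sum]
    refine Finset.sum_congr rfl fun a ha => ?_
    have ha' : ∑ j, a j = d := by
      rw [← Finsupp.degree_eq_sum, Finsupp.degree_eq_weight_one]
      exact hf (mem_support_iff.mp ha)
    simp_rw [mul_pow]
    rw [Finset.prod_mul_distrib, Finset.prod_pow_eq_pow_sum, ha', monomial_eq,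
      Finsupp.prod_fintype _ _ (by simp), algebraMap_eq, C_pow]
    ring
  have h1 : (RingHom.ker (eval (c • w))).map σ ≤ RingHom.ker (eval w) := by
    rw [Ideal.map_le_iff_le_comap]
    intro g hg
    have : (eval w).comp (σ : MvPolynomial (Fin 4) K →+* _) = eval (c • w) := by
      apply ringHom_ext <;> intro <;> simp [σ]
    exact (congrArg (fun φ : MvPolynomial (Fin 4) K →+* K => φ g) this).trans hg
  have h2 : σ f ∈ RingHom.ker (eval w) ^ m :=
    Ideal.pow_right_mono h1 m (Ideal.map_pow σ _ m ▸ Ideal.mem_map_of_mem σ hm)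
  rw [hσ] at h2
  have h3 := Ideal.mul_mem_left _ (C (c ^ d)⁻¹) h2
  rwa [← mul_assoc, ← C_mul, inv_mul_cancel₀ (pow_ne_zero d hc), C_1, one_mul] at h3

/-! ### Semicontinuity -/

theorem aeval_det_map_C_mul {I N σ R : Type*} [Fintype I] [Fintype N] [DecidableEq N]
    [CommRing R] (B : Matrix N I ℤ) (M : Matrix I N (MvPolynomial σ ℤ)) (x : σ → R) :
    aeval x (Matrix.det ((B.map C : Matrix N I (MvPolynomial σ ℤ)) * M)) =
      Matrix.det ((B.map (Int.castRingHom R) : Matrix N I R) *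
        (M.map (aeval x) : Matrix I N R)) := by
  rw [AlgHom.map_det, AlgHom.mapMatrix_apply, Matrix.map_mul]
  congr 2
  ext i j
  simp

/-- Let `B` be an integral lift of a left inverse of the matrix at `x₀`. Then `det (B * M)`
specializes to 1 modulo `p`, so it is a nonzero polynomial, and wherever it does not vanish `M` is
injective. -/
theorem exists_injective_of_injective_mod {I N : Type*} {σ : Type*} [Fintype I] [Fintype N]
    [DecidableEq N] (M : Matrix I N (MvPolynomial σ ℤ)) (p : ℕ) [Fact p.Prime] (x₀ : σ → ZMod p)
    (h : ∀ c, (M.map (aeval x₀)).mulVec c = 0 → c = 0) :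
    ∃ P : MvPolynomial σ ℤ, P ≠ 0 ∧ ∀ (K : Type u) [Field K] (x : σ → K), aeval x P ≠ 0 →
      ∀ c, (M.map (aeval x)).mulVec c = 0 → c = 0 := by
  classical
  obtain ⟨g, hg⟩ := LinearMap.exists_leftInverse_of_injective
    (Matrix.toLin' (M.map (aeval x₀))) (LinearMap.ker_eq_bot'.mpr h)
  have hC : LinearMap.toMatrix' g * M.map (aeval x₀) = 1 := by
    rw [← LinearMap.toMatrix'_toLin' (M.map (aeval x₀)), ← LinearMap.toMatrix'_comp, hg,
      LinearMap.toMatrix'_id]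
  obtain ⟨B, hB⟩ : ∃ B : Matrix N I ℤ, B.map (Int.castRingHom (ZMod p)) = LinearMap.toMatrix' g := by
    refine ⟨(LinearMap.toMatrix' g).map fun z => (z.val : ℤ), ?_⟩
    ext i j
    simp
  refine ⟨Matrix.det ((B.map C : Matrix N I (MvPolynomial σ ℤ)) * M), fun h0 => ?_,
    fun K _ x hx c hc => ?_⟩
  · have h1 := aeval_det_map_C_mul B M x₀
    rw [h0, map_zero, hB, hC, Matrix.det_one] at h1
    exact zero_ne_one h1
  · rw [aeval_det_map_C_mul] at hx
    apply Matrix.eq_zero_of_mulVec_eq_zero hx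
    rw [← Matrix.mulVec_mulVec, hc, Matrix.mulVec_zero]

theorem ForGeneralPoints.and {K : Type*} [Field K] {r : ℕ} {S T : (Fin r → P3 K) → Prop}
    (hS : ForGeneralPoints K r S) (hT : ForGeneralPoints K r T) :
    ForGeneralPoints K r fun p => S p ∧ T p := by
  obtain ⟨P, hP, hS⟩ := hS
  obtain ⟨Q, hQ, hT⟩ := hT
  refine ⟨P * Q, mul_ne_zero hP hQ, fun w hw h => ?_⟩
  rw [map_mul] at h
  exact ⟨hS w hw (left_ne_zero_of_mul h), hT w hw (right_ne_zero_of_mul h)⟩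

theorem ForGeneralPoints.mono {K : Type*} [Field K] {r : ℕ} {S T : (Fin r → P3 K) → Prop}
    (hS : ForGeneralPoints K r S) (h : ∀ p, S p → T p) : ForGeneralPoints K r T := by
  obtain ⟨P, hP, hS⟩ := hS
  exact ⟨P, hP, fun w hw hPw => h _ (hS w hw hPw)⟩

/-- The conditions that the linear system `L₃(d, m)` at the points `w` imposes on the coefficients
of the monomials in `N`. -/
def conditionMatrix {R : Type*} [CommSemiring R] {r : ℕ} (w : Fin r × Fin 4 → R)
    (S : Finset (Fin r × (Fin 4 →₀ ℕ))) (N : Finset (Fin 4 →₀ ℕ)) : Matrix S N R :=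
  Matrix.of fun s a => taylorCoeff (fun j => w (s.1.1, j)) s.1.2 a.1

theorem conditionMatrix_map {R : Type*} [CommRing R] {r : ℕ} (w : Fin r × Fin 4 → R)
    (S : Finset (Fin r × (Fin 4 →₀ ℕ))) (N : Finset (Fin 4 →₀ ℕ)) :
    (conditionMatrix (X : _ → MvPolynomial (Fin r × Fin 4) ℤ) S N).map (aeval w) =
      conditionMatrix w S N := by
  ext s a
  simpa [conditionMatrix] using map_taylorCoeff (aeval w : _ →ₐ[ℤ] R).toRingHom
    (fun j => X (s.1.1, j)) s.1.2 a.1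

theorem conditionMatrix_mulVec {R : Type*} [CommSemiring R] {r : ℕ} (w : Fin r × Fin 4 → R)
    (S : Finset (Fin r × (Fin 4 →₀ ℕ))) (N : Finset (Fin 4 →₀ ℕ)) (c : (Fin 4 →₀ ℕ) → R) (s : S) :
    (conditionMatrix w S N).mulVec (fun a => c a.1) s =
      ∑ a ∈ N, c a * taylorCoeff (fun j => w (s.1.1, j)) s.1.2 a := by
  rw [← Finset.sum_coe_sort N]
  simp only [Matrix.mulVec, dotProduct, conditionMatrix, Matrix.of_apply]
  exact Finset.sum_congr rfl fun a _ => mul_comm _ _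

/-- A bound for the dimension of a linear system at general points in characteristic zero, from
a bound at one choice of points over a prime field. -/
theorem forGeneralPoints_finrank_le (K : Type u) [Field K] [CharZero K] {r : ℕ} (d : ℕ)
    (m : Fin r → ℕ) (B : Finset (Fin 4 →₀ ℕ)) (p : ℕ) [Fact p.Prime]
    (w₀ : Fin r → Fin 4 → ZMod p)
    (h : ∀ c : (Fin 4 →₀ ℕ) → ZMod p,
      (∀ i α, α.degree < m i → ∑ a ∈ exponents d \ B, c a * taylorCoeff (w₀ i) α a = 0) →
        ∀ a ∈ exponents d \ B, c a = 0) :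
    ForGeneralPoints K r fun p => Module.finrank K (linearSystem p d m) ≤ B.card := by
  classical
  let S : Finset (Fin r × (Fin 4 →₀ ℕ)) :=
    Finset.univ.biUnion fun i => ((Finset.range (m i)).biUnion exponents).image fun α => (i, α)
  have hS : ∀ i α, (i, α) ∈ S ↔ α.degree < m i := by
    simp [S, mem_exponents]
  obtain ⟨P, hP, hPK⟩ := exists_injective_of_injective_mod
    (conditionMatrix X S (exponents d \ B)) p (fun ij => w₀ ij.1 ij.2) (by
      intro c hc
      rw [conditionMatrix_map] at hc
      let c' : (Fin 4 →₀ ℕ) → ZMod p := fun a => if ha : a ∈ exponents d \ B then c ⟨a, ha⟩ else 0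
      have hc' : (fun a : (exponents d \ B : Finset _) => c' a.1) = c := by
        ext a
        simp only [c', dif_pos a.2]
      rw [← hc']
      ext a
      refine h c' (fun i α hα => ?_) a.1 a.2
      have := congrFun hc ⟨(i, α), (hS i α).mpr hα⟩
      rwa [← hc', conditionMatrix_mulVec] at this)
  refine ⟨P.map (Int.castRingHom K), ?_, ?_⟩
  · rw [Ne, ← map_zero (MvPolynomial.map (Int.castRingHom K))]
    -- Characteristic zero enters here: a nonzero integral polynomial stays nonzero over `K`.
    exact (map_injective _ (Int.cast_injective (α := K))).ne hP
  · intro w hw hPw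
    rw [eval_map, ← algebraMap_int_eq, ← aeval_def] at hPw
    have hinj := hPK K _ hPw
    rw [conditionMatrix_map] at hinj
    -- A member of the system whose coefficients in `B` vanish is killed by the remaining columns,
    -- so these coefficients determine it.
    let Φ : linearSystem (fun i => Projectivization.mk K (w i) (hw i)) d m →ₗ[K] (B → K) :=
      LinearMap.pi fun a => lcoeff K a.1 ∘ₗ Submodule.subtype _
    have hΦ : Function.Injective Φ := by
      rw [injective_iff_map_eq_zero]
      intro f hf
      have hB : ∀ a ∈ B, coeff a f.1 = 0 := fun a ha => congrFun hf ⟨a, ha⟩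
      obtain ⟨hfh, hfm⟩ := mem_linearSystem.mp f.2
      have hz := hinj (fun a => coeff a.1 f.1) (by
        ext s
        obtain ⟨⟨i, α⟩, hs⟩ := s
        obtain ⟨u, hu⟩ := Projectivization.exists_smul_eq_mk_rep K (w i) (hw i)
        have h1 := hfm i
        rw [← hu] at h1
        have h2 := sum_taylorCoeff_eq_zero hfh (mem_ker_eval_pow_of_smul u.ne_zero hfh h1)
          ((hS i α).mp hs)
        rw [conditionMatrix_mulVec _ _ _ (fun a => coeff a f.1), Pi.zero_apply, ← h2]
        refine Finset.sum_subset Finset.sdiff_subset fun a ha ha' => ?_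
        have : a ∈ B := by
          by_contra hab
          exact ha' (Finset.mem_sdiff.mpr ⟨ha, hab⟩)
        rw [hB a this, zero_mul])
      ext a
      by_cases ha : a ∈ exponents d
      · by_cases hab : a ∈ B
        · exact hB a hab
        · exact congrFun hz ⟨a, Finset.mem_sdiff.mpr ⟨ha, hab⟩⟩
      · rw [mem_exponents] at ha
        exact hfh.coeff_eq_zero ha
    simpa using LinearMap.finrank_le_finrank_of_injective hΦ

/-! ### Gaussian elimination modulo a prime

The functions whose names end in `Then` pass their result, fully evaluated, to a continuation. -/

/-- Evaluate `n` before passing it to `k`. -/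
def evalThen {β : Type*} (n : ℕ) (k : ℕ → β) : β :=
  Nat.rec (k 0) (fun m _ => k (Nat.succ m)) n

/-- The recursor in `evalThen` does not change the value; it forces its argument to a numeral, so
that lazy reduction does not copy unevaluated arithmetic. -/
theorem evalThen_eq {β : Type*} (n : ℕ) (k : ℕ → β) : evalThen n k = k n := by
  cases n <;> rfl

/-- The row `a * s + b * r` modulo `p`. -/
def combineThen {β : Type*} (p a b : ℕ) (s : List ℕ) : List ℕ → (List ℕ → β) → β :=
  List.rec (fun _ k => k [])
    (fun x _ ih r => List.rec (fun k => k [])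
      (fun y r _ k => ih r fun l =>
        evalThen (((a.mul x).add (b.mul y)).mod p) fun n => k (n :: l)) r) s

theorem combineThen_eq {β : Type*} (p a b : ℕ) (s r : List ℕ) (k : List ℕ → β) :
    combineThen p a b s r k = k (List.zipWith (fun x y => (a * x + b * y) % p) s r) := by
  induction s generalizing r k with
  | nil => rfl
  | cons x s ih =>
    cases r with
    | nil => rfl
    | cons y r => exact (ih r _).trans (evalThen_eq _ _)

/-- Eliminate the first entry of a row with the pivot row `h :: r`. -/
def reduceThen {β : Type*} (p h : ℕ) (r : List ℕ) : List ℕ → (List ℕ → β) → β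
  | 0 :: s, k => k s
  | (x + 1) :: s, k => evalThen ((p - 1) * (x + 1)) fun b => combineThen p h b s r k
  | [], k => k []

/-- Eliminate the first entries of all rows with the pivot row `h :: r`. -/
def reduceAllThen {β : Type*} (p h : ℕ) (r : List ℕ) :
    List (List ℕ) → (List (List ℕ) → β) → β
  | [], k => k []
  | s :: l, k => reduceThen p h r s fun s' => reduceAllThen p h r l fun l' => k (s' :: l')

/-- The first row with a nonzero first entry. -/
def findPivot : List (List ℕ) → List ℕ
  | [] => []
  | ((x + 1) :: s) :: _ => (x + 1) :: s
  | _ :: l => findPivot l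

/-- Gaussian elimination finds a pivot modulo `p` in each of the `n` columns of a matrix, given as
the list of its rows. -/
def hasFullColumnRank (p : ℕ) : ℕ → List (List ℕ) → Bool
  | 0, _ => true
  | n + 1, rows =>
    match findPivot rows with
    | [] => false
    | h :: r => !Nat.beq (h % p) 0 && reduceAllThen p h r rows fun l => hasFullColumnRank p n l

/-- The product of a row with a column. -/
def rowDot {F : Type*} [Semiring F] : List ℕ → List F → F
  | x :: s, y :: c => x * y + rowDot s c
  | _, _ => 0

theorem rowDot_map {F ι : Type*} [Semiring F] (l : List ι) (f : ι → ℕ) (g : ι → F) :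
    rowDot (l.map f) (l.map g) = (l.map fun i => (f i : F) * g i).sum := by
  induction l with
  | nil => rfl
  | cons i l ih => simp [rowDot, ih]

theorem rowDot_zipWith {p : ℕ} (a b : ℕ) {s r : List ℕ} (h : s.length = r.length)
    (c : List (ZMod p)) :
    rowDot (List.zipWith (fun x y => (a * x + b * y) % p) s r) c =
      a * rowDot s c + b * rowDot r c := by
  induction s generalizing r c with
  | nil =>
    obtain rfl : r = [] := List.eq_nil_of_length_eq_zero h.symm
    simp [rowDot]
  | cons x s ih =>
    cases r with
    | nil => simp at h
    | cons y r =>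
      cases c with
      | nil => simp [rowDot]
      | cons z c =>
        simp only [List.zipWith_cons_cons, rowDot, ih (Nat.succ.inj h), ZMod.natCast_mod]
        push_cast
        ring

/-- The row obtained from a row by eliminating its first entry with the pivot row `h :: r`. -/
def reduceRow (p h : ℕ) (r s : List ℕ) : List ℕ := reduceThen p h r s id

theorem reduceThen_eq {β : Type*} (p h : ℕ) (r s : List ℕ) (k : List ℕ → β) :
    reduceThen p h r s k = k (reduceRow p h r s) := by
  rcases s with _ | ⟨_ | x, s⟩ <;> simp [reduceRow, reduceThen, evalThen_eq, combineThen_eq]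

theorem reduceAllThen_eq {β : Type*} (p h : ℕ) (r : List ℕ) (l : List (List ℕ))
    (k : List (List ℕ) → β) : reduceAllThen p h r l k = k (l.map (reduceRow p h r)) := by
  induction l generalizing k with
  | nil => rfl
  | cons s l ih => simp only [reduceAllThen, reduceThen_eq, ih, List.map_cons]

theorem findPivot_mem {l : List (List ℕ)} (h : findPivot l ≠ []) : findPivot l ∈ l := by
  induction l with
  | nil => simp [findPivot] at h
  | cons s l ih =>
    rcases s with _ | ⟨_ | x, s⟩
    · exact List.mem_cons_of_mem _ (ih h)
    · exact List.mem_cons_of_mem _ (ih h)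
    · simp [findPivot]

/-- Induction on the columns: the reduced rows annihilate the tail of a kernel vector, so the tail
vanishes, and then the pivot row kills the first entry. -/
theorem eq_zero_of_hasFullColumnRank {p : ℕ} [Fact p.Prime] {n : ℕ} {rows : List (List ℕ)}
    (hcheck : hasFullColumnRank p n rows = true) (hlen : ∀ s ∈ rows, s.length = n)
    {c : List (ZMod p)} (hc : c.length = n) (hdot : ∀ s ∈ rows, rowDot s c = 0) :
    ∀ y ∈ c, y = 0 := by
  induction n generalizing rows c with
  | zero =>
    rw [List.eq_nil_of_length_eq_zero hc]
    simp
  | succ n ih =>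
    obtain ⟨y, c, rfl⟩ := List.exists_cons_of_length_eq_add_one hc
    rw [hasFullColumnRank] at hcheck
    split at hcheck
    · simp at hcheck
    · next h r hpiv =>
      have hmem : h :: r ∈ rows := hpiv ▸ findPivot_mem (by rw [hpiv]; simp)
      have hr : r.length = n := Nat.succ.inj (hlen _ hmem)
      have hr0 := hdot _ hmem
      rw [rowDot] at hr0
      rw [reduceAllThen_eq, Bool.and_eq_true, Bool.not_eq_true'] at hcheck
      obtain ⟨hh, hcheck⟩ := hcheck
      have hh' : (h : ZMod p) ≠ 0 := by
        rw [Ne, ZMod.natCast_eq_zero_iff, Nat.dvd_iff_mod_eq_zero]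
        exact fun h0 => by simp [h0] at hh
      have htail : ∀ z ∈ c, z = 0 := by
        refine ih hcheck ?_ (Nat.succ.inj hc) ?_
        · intro s hs
          obtain ⟨s, hs', rfl⟩ := List.mem_map.mp hs
          have hl := hlen s hs'
          rcases s with _ | ⟨_ | x, s⟩
          · simp at hl
          · exact Nat.succ.inj hl
          · have : s.length = n := Nat.succ.inj hl
            simp [reduceRow, reduceThen, evalThen_eq, combineThen_eq, hr, this]
        · intro s hs
          obtain ⟨s, hs', rfl⟩ := List.mem_map.mp hs
          have hl := hlen s hs'
          have hs0 := hdot s hs'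
          rcases s with _ | ⟨_ | x, s⟩
          · simp at hl
          · simpa [rowDot, reduceRow, reduceThen] using hs0
          · have : s.length = r.length := (Nat.succ.inj hl).trans hr.symm
            simp only [reduceRow, reduceThen, evalThen_eq, combineThen_eq, id, rowDot_zipWith _ _ this]
            rw [rowDot] at hs0
            rw [eq_neg_of_add_eq_zero_right hs0, eq_neg_of_add_eq_zero_right hr0]
            -- The factor `p - 1` plays the role of `-1`, so that rows keep natural entries.
            have hp : ((p - 1 : ℕ) : ZMod p) = -1 := by
              rw [Nat.cast_sub (Fact.out (p := p.Prime)).one_le]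
              simp
            push_cast [hp]
            ring
      have hzero : rowDot r c = 0 := by
        clear * - htail
        induction r generalizing c with
        | nil => rfl
        | cons x r ih =>
          cases c with
          | nil => rfl
          | cons z c =>
            rw [rowDot, htail z (by simp), ih (c := c) fun z hz => htail z (List.mem_cons_of_mem _ hz)]
            simp
      rw [hzero, add_zero] at hr0
      intro z hz
      rcases List.mem_cons.mp hz with rfl | hz
      · exact (mul_eq_zero.mp hr0).resolve_left hh'
      · exact htail z hz

/-! ### The conditions at nine points modulo 11 -/

/-- Exponents in four variables, or integral points of projective 3-space. -/
abbrev Quad := ℕ × ℕ × ℕ × ℕ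

/-- The coordinates of a quadruple. -/
def Quad.coord (x : Quad) : Fin 4 → ℕ := ![x.1, x.2.1, x.2.2.1, x.2.2.2]

/-- A quadruple as an exponent. -/
noncomputable def Quad.exponent (x : Quad) : Fin 4 →₀ ℕ := Finsupp.equivFunOnFinite.symm x.coord

theorem Quad.exponent_injective : Function.Injective Quad.exponent := by
  intro x y h
  have h' : x.coord = y.coord := Finsupp.equivFunOnFinite.symm.injective h
  ext
  exacts [congrFun h' 0, congrFun h' 1, congrFun h' 2, congrFun h' 3]

theorem Quad.exponent_surjective : Function.Surjective Quad.exponent := by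
  intro a
  refine ⟨(a 0, a 1, a 2, a 3), ?_⟩
  ext j
  fin_cases j <;> rfl

theorem Quad.degree_exponent (x : Quad) :
    x.exponent.degree = x.1 + x.2.1 + x.2.2.1 + x.2.2.2 := by
  simp [Finsupp.degree_eq_sum, Fin.sum_univ_four, Quad.exponent, Quad.coord]

/-- The exponents of degree `d`. -/
def quads (d : ℕ) : List Quad :=
  (List.range (d + 1)).flatMap fun a => (List.range (d - a + 1)).reverse.flatMap fun b =>
    (List.range (d - a - b + 1)).reverse.map fun c => (a, b, c, d - a - b - c)

theorem mem_quads {d : ℕ} {x : Quad} :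
    x ∈ quads d ↔ x.1 + x.2.1 + x.2.2.1 + x.2.2.2 = d := by
  obtain ⟨a, b, c, e⟩ := x
  simp only [quads, List.mem_flatMap, List.mem_range, List.mem_reverse, List.mem_map,
    Prod.mk.injEq]
  constructor
  · rintro ⟨_, h1, _, h2, _, h3, rfl, rfl, rfl, rfl⟩
    omega
  · intro h
    exact ⟨a, by omega, b, by omega, c, by omega, rfl, rfl, rfl, by omega⟩

theorem nodup_quads (d : ℕ) : (quads d).Nodup := by
  rw [quads, List.nodup_flatMap]
  refine ⟨fun a _ => ?_, List.nodup_range.imp fun {a a'} h => ?_⟩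
  · rw [List.nodup_flatMap]
    refine ⟨fun b _ => ?_, (List.nodup_reverse.mpr List.nodup_range).imp fun {b b'} h => ?_⟩
    · exact (List.nodup_reverse.mpr List.nodup_range).map fun c c' h => by
        simpa using congrArg (fun x : Quad => x.2.2.1) h
    · intro x hx hx'
      simp only [List.mem_map] at hx hx'
      obtain ⟨c, -, rfl⟩ := hx
      obtain ⟨c', -, h'⟩ := hx'
      simp only [Prod.mk.injEq] at h'
      exact h h'.2.1.symm
  · intro x hx hx'
    simp only [List.mem_map, List.mem_flatMap] at hx hx'
    obtain ⟨b, -, c, -, rfl⟩ := hx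
    obtain ⟨b', -, c', -, h'⟩ := hx'
    simp only [Prod.mk.injEq] at h'
    exact h h'.1.symm

/-- The binomial coefficient, by its closed formula if `k ≤ 3`. -/
def smallChoose (a k : ℕ) : ℕ :=
  match k with
  | 0 => 1
  | 1 => a
  | 2 => a * (a - 1) / 2
  | 3 => a * (a - 1) * (a - 2) / 6
  | k + 4 => a.choose (k + 4)

theorem smallChoose_eq (a k : ℕ) : smallChoose a k = a.choose k := by
  match k with
  | 0 => simp [smallChoose]
  | 1 => simp [smallChoose]
  | 2 => rw [smallChoose, Nat.choose_two_right]
  | 3 =>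
    rw [smallChoose, Nat.choose_eq_descFactorial_div_factorial]
    simp only [Nat.descFactorial, Nat.factorial]
    congr 1
    simp
    ring
  | k + 4 => rfl

/-- The Taylor coefficients at integral points. -/
def natTaylorCoeff : Quad → Quad → Quad → ℕ
  | (w₀, w₁, w₂, w₃), (k₀, k₁, k₂, k₃), (a₀, a₁, a₂, a₃) =>
    ((((smallChoose a₀ k₀).mul (w₀.pow (a₀.sub k₀))).mul
      ((smallChoose a₁ k₁).mul (w₁.pow (a₁.sub k₁)))).mul
        ((smallChoose a₂ k₂).mul (w₂.pow (a₂.sub k₂)))).mul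
          ((smallChoose a₃ k₃).mul (w₃.pow (a₃.sub k₃)))

theorem cast_natTaylorCoeff {R : Type*} [CommSemiring R] (w k a : Quad) :
    (natTaylorCoeff w k a : R) =
      taylorCoeff (fun j => (w.coord j : R)) k.exponent a.exponent := by
  simp [natTaylorCoeff, taylorCoeff, Fin.prod_univ_four, Quad.exponent, Quad.coord, smallChoose_eq]

/-- Evaluate a list of quadruples before passing it to `k`. -/
def quadsThen {β : Type*} : List Quad → (List Quad → β) → β
  | [], k => k []
  | (a₀, a₁, a₂, a₃) :: l, k =>
    evalThen a₀ fun a₀ => evalThen a₁ fun a₁ => evalThen a₂ fun a₂ => evalThen a₃ fun a₃ =>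
      quadsThen l fun l => k ((a₀, a₁, a₂, a₃) :: l)

theorem quadsThen_eq {β : Type*} (l : List Quad) (k : List Quad → β) : quadsThen l k = k l := by
  induction l generalizing k with
  | nil => rfl
  | cons x l ih => simp only [quadsThen, evalThen_eq, ih]

/-- The condition at `w` with exponent `α` on the coefficients of given monomials, modulo `p`. -/
def rowThen {β : Type*} (p : ℕ) (w α : Quad) : List Quad → (List ℕ → β) → β
  | [], k => k []
  | a :: l, k => evalThen ((natTaylorCoeff w α a).mod p) fun n => rowThen p w α l fun r => k (n :: r)

theorem rowThen_eq {β : Type*} (p : ℕ) (w α : Quad) (l : List Quad) (k : List ℕ → β) :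
    rowThen p w α l k = k (l.map fun a => natTaylorCoeff w α a % p) := by
  induction l generalizing k with
  | nil => rfl
  | cons a l ih => simp only [rowThen, evalThen_eq, ih, List.map_cons]; rfl

/-- The conditions, modulo `p`, on the coefficients of given monomials. -/
def rowsThen {β : Type*} (p : ℕ) (monos : List Quad) :
    List (Quad × Quad) → (List (List ℕ) → β) → β
  | [], k => k []
  | (w, α₀, α₁, α₂, α₃) :: l, k =>
    evalThen α₀ fun α₀ => evalThen α₁ fun α₁ => evalThen α₂ fun α₂ => evalThen α₃ fun α₃ =>
      rowThen p w (α₀, α₁, α₂, α₃) monos fun r => rowsThen p monos l fun rows => k (r :: rows)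

theorem rowsThen_eq {β : Type*} (p : ℕ) (monos : List Quad) (conds : List (Quad × Quad))
    (k : List (List ℕ) → β) : rowsThen p monos conds k =
      k (conds.map fun x => monos.map fun a => natTaylorCoeff x.1 x.2 a % p) := by
  induction conds generalizing k with
  | nil => rfl
  | cons x l ih => simp only [rowsThen, evalThen_eq, rowThen_eq, ih, List.map_cons]

/-- The conditions determine the coefficients of the given monomials modulo `p`. -/
def conditionsIndependent (p : ℕ) (monos : List Quad) (conds : List (Quad × Quad)) : Bool :=
  quadsThen monos fun monos => rowsThen p monos conds fun rows =>
    hasFullColumnRank p monos.length rows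

theorem eq_zero_of_conditionsIndependent {p : ℕ} [Fact p.Prime] {monos : List Quad}
    {conds : List (Quad × Quad)} (h : conditionsIndependent p monos conds = true)
    {c : Quad → ZMod p}
    (hc : ∀ x ∈ conds, (monos.map fun a => (natTaylorCoeff x.1 x.2 a : ZMod p) * c a).sum = 0) :
    ∀ a ∈ monos, c a = 0 := by
  rw [conditionsIndependent, quadsThen_eq, rowsThen_eq] at h
  have := eq_zero_of_hasFullColumnRank h (c := monos.map c) ?_ (by simp) ?_
  · exact fun a ha => this _ (List.mem_map_of_mem ha)
  · intro s hs
    obtain ⟨x, -, rfl⟩ := List.mem_map.mp hs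
    simp
  · intro s hs
    obtain ⟨x, hx, rfl⟩ := List.mem_map.mp hs
    rw [rowDot_map, ← hc x hx]
    simp only [ZMod.natCast_mod]

/-- Five points of projective 3-space that are in sufficiently general position with respect to
the coordinate points, modulo 11. -/
def basePoints : List Quad := [(1, 6, 0, 9), (4, 1, 3, 0), (1, 1, 1, 1), (9, 0, 10, 1), (0, 5, 9, 2)]

/-- The exponents of degree `d` of monomials that have multiplicity at least `a` at the first
coordinate point and at least `b` at the other ones, without those in `free`. -/
def monomials (d a b : ℕ) (free : List Quad) : List Quad :=
  (quads d).filter fun x => Nat.ble (x.1 + a) d && (Nat.ble (x.2.1 + b) d &&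
    (Nat.ble (x.2.2.1 + b) d && (Nat.ble (x.2.2.2 + b) d && !free.contains x)))

theorem mem_monomials {d a b : ℕ} {free : List Quad} {x : Quad} :
    x ∈ monomials d a b free ↔ x ∈ quads d ∧ (x.1 + a ≤ d ∧ x.2.1 + b ≤ d ∧ x.2.2.1 + b ≤ d ∧
      x.2.2.2 + b ≤ d) ∧ x ∉ free := by
  simp [monomials, and_assoc]

/-- The coordinate points followed by the points in `basePoints`, modulo 11. -/
def ninePoints (i : Fin 9) (j : Fin 4) : ZMod 11 :=
  if h : i.val < 4 then (if (⟨i.val, h⟩ : Fin 4) = j then 1 else 0)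
  else (basePoints.getD (i.val - 4) (0, 0, 0, 0)).coord j

/-- Off `j` a factor survives only if the exponents agree, because of the binomial coefficient on
one side and the power of 0 on the other. Equal degrees then force agreement at `j`. Hence a
condition at a coordinate point isolates a single coefficient. -/
theorem taylorCoeff_single_erase {R : Type*} [CommSemiring R] (j : Fin 4) {a x : Fin 4 →₀ ℕ}
    (h : a.degree = x.degree) :
    taylorCoeff (fun l => if j = l then (1 : R) else 0) (x.erase j) a = if a = x then 1 else 0 := by
  split_ifs with hax
  · subst hax
    refine Finset.prod_eq_one fun l _ => ?_
    by_cases hl : j = l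
    · subst hl; simp
    · simp [Finsupp.erase_ne (Ne.symm hl)]
  · obtain ⟨l, hlj, hl⟩ : ∃ l, l ≠ j ∧ a l ≠ x l := by
      by_contra! hne
      apply hax
      ext l
      by_cases hl : l = j
      · subst hl
        rw [Finsupp.degree_eq_sum, Finsupp.degree_eq_sum,
          ← Finset.add_sum_erase _ _ (Finset.mem_univ l),
          ← Finset.add_sum_erase _ _ (Finset.mem_univ l),
          Finset.sum_congr rfl fun i hi => hne i (Finset.ne_of_mem_erase hi)] at h
        exact Nat.add_right_cancel h
      · exact hne l hl
    refine Finset.prod_eq_zero (Finset.mem_univ l) ?_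
    rw [Finsupp.erase_ne hlj]
    beta_reduce
    rw [if_neg hlj.symm]
    rcases Nat.lt_or_gt_of_ne hl with h1 | h1
    · rw [Nat.choose_eq_zero_of_lt h1, Nat.cast_zero, zero_mul]
    · rw [zero_pow (by omega), mul_zero]

/-- At nine general points, the system `L₃(d, a, b⁸)` has at most as many independent members as
there are exponents in `free`, if the remaining coefficients are determined at one choice of
points modulo 11. -/
theorem forGeneralPoints_finrank_le_of_check (K : Type u) [Field K] [CharZero K] (d a b : ℕ)
    (hb : 0 < b) (free : List Quad)
    (hcheck : conditionsIndependent 11 (monomials d a b free)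
      (basePoints ×ˢ quads (b - 1)) = true) :
    ForGeneralPoints K 9 fun p =>
      Module.finrank K (linearSystem p d (nineMult a b)) ≤ free.length := by
  classical
  have : Fact (Nat.Prime 11) := ⟨by norm_num⟩
  let B : Finset (Fin 4 →₀ ℕ) := (free.map Quad.exponent).toFinset
  have hB : ∀ x : Quad, x.exponent ∈ B ↔ x ∈ free := fun x => by
    simp [B, Quad.exponent_injective.eq_iff]
  refine (forGeneralPoints_finrank_le K d (nineMult a b) B 11 ninePoints ?_).mono
    fun p hp => hp.trans ((List.toFinset_card_le _).trans (List.length_map _).le)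
  intro c hc
  -- The inequality says that the part of `x` off `j` has degree below the multiplicity at the
  -- `j`-th coordinate point, so the condition with that exponent gives `c x = 0`.
  have hcoord : ∀ x ∈ exponents d \ B, ∀ j : Fin 4,
      d < (if j = 0 then a else b) + x j → c x = 0 := by
    intro x hx j hj
    have hdeg := mem_exponents.mp (Finset.mem_sdiff.mp hx).1
    have h1 : (x.erase j).degree + x j = d := by
      rw [← hdeg]
      conv_rhs => rw [← Finsupp.erase_add_single j x]
      simp
    have h2 := hc (j.castLE (by norm_num)) (x.erase j) (by
      have : nineMult a b (j.castLE (by norm_num)) = if j = 0 then a else b := by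
        fin_cases j <;> rfl
      omega)
    have h3 : ninePoints (j.castLE (by norm_num)) = fun l => if j = l then 1 else 0 := by
      ext l
      simp [ninePoints]
    rw [h3, Finset.sum_congr rfl fun y hy => by
      rw [taylorCoeff_single_erase j
        ((mem_exponents.mp (Finset.mem_sdiff.mp hy).1).trans hdeg.symm)]] at h2
    simpa [hx] using h2
  have hmono : ∀ x : Quad, x.exponent ∈ exponents d \ B → x ∉ monomials d a b free →
      c x.exponent = 0 := by
    intro x hx hxm
    obtain ⟨hx1, hx2⟩ := Finset.mem_sdiff.mp hx
    rw [mem_exponents, Quad.degree_exponent, ← mem_quads] at hx1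
    rw [hB] at hx2
    by_contra hne
    refine hxm (mem_monomials.mpr ⟨hx1, ⟨?_, ?_, ?_, ?_⟩, hx2⟩)
    · exact not_lt.mp fun h => hne (hcoord _ hx 0 (by rw [add_comm]; exact h))
    · exact not_lt.mp fun h => hne (hcoord _ hx 1 (by rw [add_comm]; exact h))
    · exact not_lt.mp fun h => hne (hcoord _ hx 2 (by rw [add_comm]; exact h))
    · exact not_lt.mp fun h => hne (hcoord _ hx 3 (by rw [add_comm]; exact h))
  have hsub : ((monomials d a b free).map Quad.exponent).toFinset ⊆ exponents d \ B := by
    intro x hx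
    rw [List.mem_toFinset] at hx
    obtain ⟨y, hy, rfl⟩ := List.mem_map.mp hx
    obtain ⟨h1, -, h2⟩ := mem_monomials.mp hy
    rw [Finset.mem_sdiff, hB, mem_exponents, Quad.degree_exponent, ← mem_quads]
    exact ⟨h1, h2⟩
  have hnodup : ((monomials d a b free).map Quad.exponent).Nodup :=
    ((nodup_quads d).filter _).map Quad.exponent_injective
  have key := eq_zero_of_conditionsIndependent hcheck (c := fun x => c x.exponent) (by
    rintro ⟨w, α⟩ hx
    rw [List.mem_product] at hx
    obtain ⟨hw, hα⟩ := hx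
    obtain ⟨i, hi, hwi⟩ : ∃ i : Fin 9, i ≠ 0 ∧ ninePoints i = fun j => (w.coord j : ZMod 11) := by
      simp only [basePoints, List.mem_cons, List.not_mem_nil, or_false] at hw
      rcases hw with rfl | rfl | rfl | rfl | rfl
      exacts [⟨4, by decide, rfl⟩, ⟨5, by decide, rfl⟩, ⟨6, by decide, rfl⟩, ⟨7, by decide, rfl⟩,
        ⟨8, by decide, rfl⟩]
    -- At the other five points only the conditions of order exactly `b - 1` are used; this is below
    -- `b` because `b` is positive.
    have h1 := hc i α.exponent (by
      rw [Quad.degree_exponent, mem_quads.mp hα, nineMult, if_neg hi]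
      omega)
    rw [hwi, ← Finset.sum_subset hsub, List.sum_toFinset _ hnodup, List.map_map] at h1
    · rw [← h1]
      congr 1
      refine List.map_congr_left fun x _ => ?_
      rw [Function.comp_apply, cast_natTaylorCoeff, mul_comm]
    · intro x hx hx'
      obtain ⟨x, rfl⟩ := Quad.exponent_surjective x
      rw [hmono x hx fun h => hx' (List.mem_toFinset.mpr (List.mem_map_of_mem h)), zero_mul])
  intro x hx
  obtain ⟨x, rfl⟩ := Quad.exponent_surjective x
  by_cases hxm : x ∈ monomials d a b free
  · exact key x hxm
  · exact hmono x hx hxm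

/-- Six squarefree monomials survive at the coordinate points; with one left free, the five other
points give five conditions on five coefficients. -/
theorem forGeneralPoints_finrank_quadrics_le (K : Type u) [Field K] [CharZero K] :
    ForGeneralPoints K 9 fun p => Module.finrank K (linearSystem p 2 (nineMult 1 1)) ≤ 1 :=
  forGeneralPoints_finrank_le_of_check K 2 1 1 one_pos [(1, 1, 0, 0)] (by decide +kernel)

/-- Of the 220 monomials, 220 - 56 - 3 · 20 = 104 survive at the coordinate points, and the other
five points give 5 · 20 = 100 conditions of order 3. Five monomials are left free, one more than 104
- 100, and the other 99 columns are independent modulo 11. -/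
theorem forGeneralPoints_finrank_nonics_le (K : Type u) [Field K] [CharZero K] :
    ForGeneralPoints K 9 fun p => Module.finrank K (linearSystem p 9 (nineMult 6 4)) ≤ 5 :=
  forGeneralPoints_finrank_le_of_check K 9 6 4 (by norm_num)
    [(3, 1, 1, 4), (3, 1, 0, 5), (3, 0, 3, 3), (3, 0, 2, 4), (3, 0, 1, 5)] (by decide +kernel)

end FatPoints

theorem mainTheorem3 (K : Type*) [Field K] :
    -- the virtual dimensions of `L = F + M`
    (∀ (r e d : ℕ) (n m : Fin r → ℕ),
      FatPoints.tildeClass (e + d) (n + m) =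
          FatPoints.tildeClass e n + FatPoints.tildeClass d m ∧
        (FatPoints.virtualDim (e + d) (n + m) : ℚ) =
          FatPoints.virtualDim e n + FatPoints.virtualDim d m + FatPoints.correction e n d m) ∧
    -- the criterion
    (∀ (r : ℕ) (p : Fin r → FatPoints.P3 K), Function.Injective p →
      ∀ (f : MvPolynomial (Fin 4) K) (e d : ℕ) (n m : Fin r → ℕ),
        FatPoints.HasFixedPart p f e n d m →
        FatPoints.linearSystem p (e + d) (n + m) ≠ ⊥ →
        ¬ FatPoints.IsSpecial p d m →
          FatPoints.effectiveDim p (e + d) (n + m) = FatPoints.effectiveDim p d m ∧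
          ((FatPoints.virtualDim e n : ℚ) + FatPoints.correction e n d m < 0 →
            FatPoints.IsSpecial p (e + d) (n + m))) ∧
    -- the numbers for `L₃(9, 6, 4⁸) = Q + L₃(7, 5, 3⁸)`
    (FatPoints.virtualDim 2 (FatPoints.nineMult 1 1) = 0 ∧
      FatPoints.correction 2 (FatPoints.nineMult 1 1) 7 (FatPoints.nineMult 5 3) = -1) ∧
    -- `L₃(9, 6, 4⁸)` is special
    (∀ p : Fin 9 → FatPoints.P3 K, Function.Injective p →
      FatPoints.IsSpecial p 9 (FatPoints.nineMult 6 4)) ∧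
    -- for general points the criterion applies to `L₃(9, 6, 4⁸)`, with `Q` as fixed part
    (CharZero K → FatPoints.ForGeneralPoints K 9 (fun p =>
      FatPoints.nineMult 6 4 = FatPoints.nineMult 1 1 + FatPoints.nineMult 5 3 ∧
      ∃ q : MvPolynomial (Fin 4) K,
        FatPoints.linearSystem p 2 (FatPoints.nineMult 1 1) = Submodule.span K {q} ∧
        FatPoints.HasFixedPart p q 2 (FatPoints.nineMult 1 1) 7 (FatPoints.nineMult 5 3) ∧
        FatPoints.linearSystem p 9 (FatPoints.nineMult 6 4) ≠ ⊥ ∧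
        ¬ FatPoints.IsSpecial p 7 (FatPoints.nineMult 5 3))) := by
  refine ⟨fun r e d n m => ⟨FatPoints.tildeClass_add e d n m, FatPoints.virtualDim_add e d n m⟩,
    fun r p _ f e d n m h hne _ => ⟨FatPoints.effectiveDim_eq_of_hasFixedPart h,
      FatPoints.isSpecial_of_hasFixedPart h hne⟩,
    ⟨?_, FatPoints.correction_nineMult⟩, fun p _ => FatPoints.isSpecial_nonics p, fun _ => ?_⟩
  · rw [FatPoints.virtualDim_nineMult]
    norm_num [Nat.choose]
  · exact ((FatPoints.forGeneralPoints_finrank_quadrics_le K).and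
      (FatPoints.forGeneralPoints_finrank_nonics_le K)).mono fun p h =>
        ⟨FatPoints.nineMult_add 1 1 5 3, FatPoints.fixedPart_nonics h.1 h.2⟩
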